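/- Let $d\ge 3$ and $1\le k\le d-2$. Let $P\subset\mathbb{R}^d$ be a $d$-polytope that is $k$-simplicial, i.e. all of its $k$-dimensional faces are $k$-simplices. For a facet $F$ of $P$ let $H_F$ be the affine hyperplane spanned by $F$, let $H_F^+$ be the open half-space bounded by $H_F$ whose closure contains $P$, and let $H_F^-$ be the opposite open half-space. Let $\operatorname{adj}(F)$ be the set of facets of $P$ that meet $F$ in a $(d-2)$-face of $P$ (the facets adjacent to $F$). Let $S$ be a facet of $P$ that is a $(d-1)$-simplex and is in bounded position: for any $d$ facets in $\operatorname{adj}(S)$ the hyperplanes spanned by them intersect in exactly one point, and this point lies in $H_S^-$. Let $\mathcal F,\mathcal N\subseteq\operatorname{adj}(S)$ be disjoint, and let $\mathcal F$ be nonsimple: no two adjacent facets $G,G'\in\mathcal F$ have a common $(d-3)$-face with $S$. Let $\mathcal V$ be the set of all points $v\in\mathbb{R}^d$ such that - $v\in H_S^-$, and $v\in H_G^-$ for all $G\in\mathcal N$; - $v\in H_G$ for all $G\in\mathcal F$; - $v\in H_G^+$ for all facets $G$ of $P$ not in $\{S\}\cup\mathcal F\cup\mathcal N$. A pseudo-stacking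 of $P$ above $S$ with respect to $\mathcal F$ and $\mathcal N$ is a polytope $\operatorname{conv}(P\cup\{v\})$ with $v\in\mathcal V$. Then such a pseudo-stacking exists (that is, $\mathcal V\neq\emptyset$), and every pseudo-stacking of $P$ above $S$ with respect to $\mathcal F$ and $\mathcal N$ is again a $k$-simplicial $d$-polytope. -/

import Mathlib

open scoped RealInnerProductSpace

/-- Euclidean space `ℝᵈ`. -/
abbrev EucSpace (d : ℕ) : Type := EuclideanSpace ℝ (Fin d)

/-- A `d`-polytope in `ℝᵈ`: the convex hull of finitely many points, of full dimension `d`. -/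
def IsDPolytope {d : ℕ} (P : Set (EucSpace d)) : Prop :=
  (∃ V : Set (EucSpace d), V.Finite ∧ P = convexHull ℝ V) ∧ affineSpan ℝ P = ⊤

/-- `F` is a face of `P` of dimension `k`.  A face is the set of maximisers on `P` of a linear
functional; `IsExposed` also admits the empty face, which has dimension `-1` and is excluded. -/
def IsFaceOfDim {d : ℕ} (P : Set (EucSpace d)) (k : ℕ) (F : Set (EucSpace d)) : Prop :=
  IsExposed ℝ P F ∧ F.Nonempty ∧ Module.finrank ℝ (vectorSpan ℝ F) = k

/-- `F` is a nonempty face of codimension `c` of the `d`-polytope `P`. -/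
def IsFaceOfCodim {d : ℕ} (P : Set (EucSpace d)) (c : ℕ) (F : Set (EucSpace d)) : Prop :=
  ∃ m : ℕ, m + c = d ∧ IsFaceOfDim P m F

/-- Facets are the faces of codimension one. -/
def IsFacet {d : ℕ} (P F : Set (EucSpace d)) : Prop := IsFaceOfCodim P 1 F

/-- Ridges are the faces of codimension two. -/
def IsRidge {d : ℕ} (P F : Set (EucSpace d)) : Prop := IsFaceOfCodim P 2 F

/-- Subridges are the faces of codimension three, that is, of dimension `d - 3`. -/
def IsSubridge {d : ℕ} (P F : Set (EucSpace d)) : Prop := IsFaceOfCodim P 3 F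

/-- `F` is an `m`-simplex: the convex hull of `m + 1` affinely independent points. -/
def IsSimplexOfDim {d : ℕ} (m : ℕ) (F : Set (EucSpace d)) : Prop :=
  ∃ s : Affine.Simplex ℝ (EucSpace d) m, F = convexHull ℝ (Set.range s.points)

/-- `P` is `k`-simplicial: all its `k`-dimensional faces are `k`-simplices. -/
def IsKSimplicial {d : ℕ} (k : ℕ) (P : Set (EucSpace d)) : Prop :=
  ∀ F, IsFaceOfDim P k F → IsSimplexOfDim k F

/-- `S` is a simplex facet of `P`: a facet that is a `(d-1)`-simplex. -/
def IsSimplexFacet {d : ℕ} (P S : Set (EucSpace d)) : Prop :=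
  IsFacet P S ∧ ∃ m : ℕ, m + 1 = d ∧ IsSimplexOfDim m S

/-- The set `adj F` of facets of `P` adjacent to `F`, that is, meeting `F` in a ridge of `P`. -/
def adjFacets {d : ℕ} (P F : Set (EucSpace d)) : Set (Set (EucSpace d)) :=
  {G | IsFacet P G ∧ IsRidge P (F ∩ G)}

/-- The hyperplane `H_F` spanned by a facet `F`. -/
def facetHyperplane {d : ℕ} (F : Set (EucSpace d)) : Set (EucSpace d) :=
  (affineSpan ℝ F : Set (EucSpace d))

/-- `{x | ⟪u, x⟫ = ℓ}` is a hyperplane containing `F`, and `P` lies in `{x | ℓ ≤ ⟪u, x⟫}`.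
For a facet `F` of a `d`-polytope `P` the pair `(u, ℓ)` is unique up to a positive factor, and the
hyperplane is `H_F`. -/
def IsInnerNormal {d : ℕ} (P F : Set (EucSpace d)) (u : EucSpace d) (ℓ : ℝ) : Prop :=
  u ≠ 0 ∧ (∀ y ∈ F, ⟪u, y⟫ = ℓ) ∧ ∀ y ∈ P, ℓ ≤ ⟪u, y⟫

/-- The open half-space `H_F⁺` of points beneath the facet `F` of `P`. -/
def beneath {d : ℕ} (P F : Set (EucSpace d)) : Set (EucSpace d) :=
  {x | ∃ u ℓ, IsInnerNormal P F u ℓ ∧ ℓ < ⟪u, x⟫}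

/-- The open half-space `H_F⁻` of points beyond the facet `F` of `P`. -/
def beyond {d : ℕ} (P F : Set (EucSpace d)) : Set (EucSpace d) :=
  {x | ∃ u ℓ, IsInnerNormal P F u ℓ ∧ ⟪u, x⟫ < ℓ}

/-- The facet `F` of `P` is in bounded position: the hyperplanes of any `d` facets adjacent to `F`
intersect in exactly one point, and this point is beyond `F`. -/
def InBoundedPosition {d : ℕ} (P F : Set (EucSpace d)) : Prop :=
  ∀ T : Set (Set (EucSpace d)), T ⊆ adjFacets P F → T.ncard = d →
    ∃ p, (⋂ G ∈ T, facetHyperplane G) = {p} ∧ p ∈ beyond P F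

/-- A set `A` of facets adjacent to the facet `F` is nonsimple: no two adjacent members of `A`
have a common `(d-3)`-face with `F`. -/
def IsNonsimple {d : ℕ} (P F : Set (EucSpace d)) (A : Set (Set (EucSpace d))) : Prop :=
  ¬ ∃ G ∈ A, ∃ G' ∈ A, G' ∈ adjFacets P G ∧ ∃ R, IsSubridge P R ∧ R ⊆ F ∩ G ∩ G'

/-- The region from which the new vertex is chosen: the points beyond `S` and the facets in `N`,
on the hyperplanes of the facets in `A`, and beneath all other facets of `P`. -/
def stackingRegion {d : ℕ} (P S : Set (EucSpace d)) (A N : Set (Set (EucSpace d))) :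
    Set (EucSpace d) :=
  {v | (∀ G, IsFacet P G → G ∉ A → G ∉ N → G ≠ S → v ∈ beneath P G) ∧
    (∀ G ∈ A, v ∈ facetHyperplane G) ∧
    (∀ G ∈ N, v ∈ beyond P G) ∧ v ∈ beyond P S}

/-- `Q` is a pseudo-stacking of `P` above `S` with respect to `A` and `N`. -/
def IsPseudoStacking {d : ℕ} (P S : Set (EucSpace d)) (A N : Set (Set (EucSpace d)))
    (Q : Set (EucSpace d)) : Prop :=
  ∃ v ∈ stackingRegion P S A N, Q = convexHull ℝ (P ∪ {v})

/-!
Throughout, a face of `P` is the zero set on `P` of an affine functional `⟪u, ·⟫ - ℓ` that is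
nonnegative on `P` (`zeroFace`); it is the convex hull of the generators of `P` that it contains.

*Existence.*  Each ridge in the simplex facet `S` lies in exactly one other facet, so `S` has exactly
`d` adjacent facets `G i`, one opposite to each vertex `w i` of `S`.  By bounded position their
hyperplanes meet in a point `p` beyond `S`.  The vectors `w i - p` form a basis, dual up to positive
factors to the inner normals of the `G i`, and a comparison of coordinates shows that `p` is strictly
beneath every facet other than `S` and the `G i` (`ApexConfig.lt_inner_apex_of_ne`).  So `p` can be
moved slightly to any prescribed sides of the hyperplanes of the `G i`
(`stackingRegion_nonempty`).

*Simpliciality.*  Let `F` be a `k`-face of `conv (P ∪ {v})`, cut out by a supporting hyperplane `H`.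
If `v ∉ F`, then `F` is a `k`-face of `P`.  Otherwise `F = conv ((P ∩ H) ∪ {v})`.  When
`v ∉ aff (P ∩ H)`, this is a pyramid over a `(k-1)`-face of `P`; that face lies in a `k`-face
(`IsFaceOfDim.exists_superset`), hence is a simplex, and so is the pyramid.  The case
`v ∈ aff (P ∩ H)` does not occur: here `P ∩ H` has dimension `k ≤ d - 2`, hence lies in a ridge
`G ∩ G'` of `P`, and `v` lies in the hyperplanes of `G` and `G'`.  The choice of `v` gives
`G, G' ∈ A`; but two facets adjacent to the simplex `S` always share a subridge with `S`, so `G` and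
`G'`, being adjacent, contradict that `A` is nonsimple (`notMem_affineSpan_of_isRidge`).
-/

/-! ### Faces as zero sets of affine functionals -/

section
variable {E : Type*} [NormedAddCommGroup E] [InnerProductSpace ℝ E]

/-- The subset of `X` on which the affine functional `⟪u, ·⟫ - ℓ` vanishes.  It is a face of `X`
when the functional is nonnegative on `X`. -/
def zeroFace (X : Set E) (u : E) (ℓ : ℝ) : Set E := {x ∈ X | ⟪u, x⟫ = ℓ}

theorem isExposed_iff_exists_zeroFace [CompleteSpace E] {P F : Set E} (hF : F.Nonempty) :
    IsExposed ℝ P F ↔ ∃ (u : E) (ℓ : ℝ), (∀ x ∈ P, ℓ ≤ ⟪u, x⟫) ∧ F = zeroFace P u ℓ := by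
  constructor
  · intro h
    obtain ⟨l, hl⟩ := h hF
    obtain ⟨a, ha⟩ := hF
    have haF := ha
    rw [hl] at ha
    refine ⟨-(InnerProductSpace.toDual ℝ E).symm l, -l a, ?_, ?_⟩
    · intro x hx
      simpa using ha.2 x hx
    · rw [hl]
      ext x
      simp only [zeroFace, Set.mem_ofPred_eq, inner_neg_left,
        InnerProductSpace.toDual_symm_apply, neg_inj]
      constructor
      · rintro ⟨hx, hm⟩
        exact ⟨hx, le_antisymm (ha.2 x hx) (hm a ha.1)⟩
      · rintro ⟨hx, hm⟩
        exact ⟨hx, fun y hy => hm ▸ ha.2 y hy⟩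
  · rintro ⟨u, ℓ, hP, rfl⟩ -
    obtain ⟨a, ha⟩ := hF
    refine ⟨-(innerSL ℝ u), ?_⟩
    ext x
    simp only [zeroFace, Set.mem_ofPred_eq, neg_apply, innerSL_apply_apply,
      neg_le_neg_iff]
    constructor
    · rintro ⟨hx, hm⟩
      exact ⟨hx, fun y hy => hm ▸ hP y hy⟩
    · rintro ⟨hx, hm⟩
      exact ⟨hx, le_antisymm (ha.2 ▸ hm a ha.1) (hP x hx)⟩

theorem convex_inner_eq (u : E) (ℓ : ℝ) : Convex ℝ {x : E | ⟪u, x⟫ = ℓ} :=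
  convex_hyperplane (innerₛₗ ℝ u).isLinear ℓ

theorem le_inner_of_mem_convexHull {V : Set E} {u : E} {ℓ : ℝ} (hV : ∀ x ∈ V, ℓ ≤ ⟪u, x⟫) :
    ∀ x ∈ convexHull ℝ V, ℓ ≤ ⟪u, x⟫ := fun _ hx =>
  convexHull_min (t := {x : E | ℓ ≤ ⟪u, x⟫}) hV
    (convex_halfSpace_ge (innerₛₗ ℝ u).isLinear ℓ) hx

/-- A face of a convex hull is spanned by the generators that it contains. -/
theorem zeroFace_convexHull {V : Set E} {u : E} {ℓ : ℝ} (hV : ∀ x ∈ V, ℓ ≤ ⟪u, x⟫) :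
    zeroFace (convexHull ℝ V) u ℓ = convexHull ℝ (zeroFace V u ℓ) := by
  apply Set.Subset.antisymm
  · rintro x ⟨hx, hxl⟩
    have key : convexHull ℝ V ⊆
        {x : E | ℓ ≤ ⟪u, x⟫ ∧ (⟪u, x⟫ = ℓ → x ∈ convexHull ℝ (zeroFace V u ℓ))} := by
      refine convexHull_min (fun y hy => ⟨hV y hy, fun h => subset_convexHull ℝ _ ⟨hy, h⟩⟩) ?_
      rintro y ⟨hy, hy'⟩ z ⟨hz, hz'⟩ a b ha hb hab
      have e : ⟪u, a • y + b • z⟫ = a * ⟪u, y⟫ + b * ⟪u, z⟫ := by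
        simp [inner_add_right, inner_smul_right]
      refine ⟨?_, fun h => ?_⟩
      · rw [e]
        have h1 : ℓ = a * ℓ + b * ℓ := by rw [← add_mul, hab, one_mul]
        nlinarith [mul_nonneg ha (sub_nonneg.2 hy), mul_nonneg hb (sub_nonneg.2 hz)]
      rw [e] at h
      rcases ha.eq_or_lt with rfl | ha
      · obtain rfl : b = 1 := by linarith
        simpa using hz' (by linarith)
      rcases hb.eq_or_lt with rfl | hb
      · obtain rfl : a = 1 := by linarith
        simpa using hy' (by linarith)
      have h1 : a * (⟪u, y⟫ - ℓ) + b * (⟪u, z⟫ - ℓ) = 0 := by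
        linear_combination h - ℓ * hab
      have h2 : 0 ≤ a * (⟪u, y⟫ - ℓ) := mul_nonneg ha.le (by linarith)
      have h3 : 0 ≤ b * (⟪u, z⟫ - ℓ) := mul_nonneg hb.le (by linarith)
      have h4 : ⟪u, y⟫ = ℓ := by
        have : a * (⟪u, y⟫ - ℓ) = 0 := by linarith
        rcases mul_eq_zero.1 this with h | h <;> linarith
      have h5 : ⟪u, z⟫ = ℓ := by
        have : b * (⟪u, z⟫ - ℓ) = 0 := by linarith
        rcases mul_eq_zero.1 this with h | h <;> linarith
      exact convex_convexHull ℝ _ (hy' h4) (hz' h5) ha.le hb.le hab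
    exact (key hx).2 hxl
  · refine convexHull_min (fun y hy => ⟨subset_convexHull ℝ _ hy.1, hy.2⟩) ?_
    exact (convex_convexHull ℝ V).inter (convex_inner_eq u ℓ)

/-! ### Affine spans and dimension -/

theorem inner_eq_of_mem_affineSpan {F : Set E} {u : E} {ℓ : ℝ} (hF : ∀ x ∈ F, ⟪u, x⟫ = ℓ)
    {x : E} (hx : x ∈ affineSpan ℝ F) : ⟪u, x⟫ = ℓ := by
  refine affineSpan_induction hx hF ?_
  intro c a b w ha hb hw
  simp [inner_add_right, inner_smul_right, inner_sub_right, ha, hb, hw]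

theorem inter_affineSpan_zeroFace (P : Set E) (u : E) (ℓ : ℝ) :
    P ∩ affineSpan ℝ (zeroFace P u ℓ) = zeroFace P u ℓ :=
  Set.Subset.antisymm
    (fun _ hx => ⟨hx.1, inner_eq_of_mem_affineSpan (fun _ hy => hy.2) hx.2⟩)
    fun _ hx => ⟨hx.1, subset_affineSpan ℝ _ hx⟩

/-- Nested sets with the same dimension have the same affine span. -/
theorem affineSpan_eq_of_subset_of_finrank_le [FiniteDimensional ℝ E] {F G : Set E}
    (hF : F.Nonempty) (h : F ⊆ G)
    (hd : Module.finrank ℝ (vectorSpan ℝ G) ≤ Module.finrank ℝ (vectorSpan ℝ F)) :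
    affineSpan ℝ F = affineSpan ℝ G := by
  obtain ⟨a, ha⟩ := hF
  refine AffineSubspace.ext_of_direction_eq ?_ ⟨a, subset_affineSpan ℝ _ ha,
    subset_affineSpan ℝ _ (h ha)⟩
  rw [direction_affineSpan, direction_affineSpan]
  exact Submodule.eq_of_le_of_finrank_le (vectorSpan_mono ℝ h) hd

theorem vectorSpan_convexHull (X : Set E) : vectorSpan ℝ (convexHull ℝ X) = vectorSpan ℝ X := by
  rw [← direction_affineSpan, affineSpan_convexHull, direction_affineSpan]

theorem vectorSpan_insert_of_mem_affineSpan {X : Set E} {v : E} (hv : v ∈ affineSpan ℝ X) :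
    vectorSpan ℝ (insert v X) = vectorSpan ℝ X := by
  rw [← direction_affineSpan, affineSpan_insert_eq_affineSpan ℝ hv, direction_affineSpan]

theorem finrank_vectorSpan_insert_of_notMem [FiniteDimensional ℝ E] {X : Set E} {v : E}
    (hX : X.Nonempty) (hv : v ∉ affineSpan ℝ X) :
    Module.finrank ℝ (vectorSpan ℝ (insert v X)) = Module.finrank ℝ (vectorSpan ℝ X) + 1 := by
  obtain ⟨a, ha⟩ := hX
  have ha' := subset_affineSpan ℝ X ha
  have h1 : vectorSpan ℝ (insert v X) = vectorSpan ℝ X ⊔ ℝ ∙ (v - a) := by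
    rw [← direction_affineSpan, ← affineSpan_insert_affineSpan,
      AffineSubspace.direction_affineSpan_insert ha', direction_affineSpan, sup_comm, vsub_eq_sub]
  rw [h1, Submodule.finrank_sup_span_singleton]
  intro h
  rw [← direction_affineSpan] at h
  exact hv (by simpa using AffineSubspace.vadd_mem_of_mem_direction h ha')

/-! ### Larger and smaller faces of a polytope -/

/-- Every nonempty proper face of a polytope lies in a face of dimension one more.  Seen from a point of the
given face, the vertices off it, projected along the face and divided by their height over it, are
the points of a vertex figure; the one of largest norm is a vertex of that figure. -/
theorem exists_zeroFace_finrank_succ [FiniteDimensional ℝ E] {V : Set E} (hV : V.Finite) {u : E}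
    {ℓ : ℝ} (hl : ∀ x ∈ V, ℓ ≤ ⟪u, x⟫) (hne : (zeroFace (convexHull ℝ V) u ℓ).Nonempty)
    (hproper : zeroFace (convexHull ℝ V) u ℓ ≠ convexHull ℝ V) :
    ∃ (u' : E) (ℓ' : ℝ), (∀ x ∈ convexHull ℝ V, ℓ' ≤ ⟪u', x⟫) ∧
      zeroFace (convexHull ℝ V) u ℓ ⊆ zeroFace (convexHull ℝ V) u' ℓ' ∧
      Module.finrank ℝ (vectorSpan ℝ (zeroFace (convexHull ℝ V) u' ℓ')) =
        Module.finrank ℝ (vectorSpan ℝ (zeroFace (convexHull ℝ V) u ℓ)) + 1 := by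
  set F := zeroFace (convexHull ℝ V) u ℓ with hF
  obtain ⟨a, ha⟩ := hne
  set W := vectorSpan ℝ F with hW
  set π := Wᗮ.starProjection with hπ
  set y : E → E := fun x => (⟪u, x⟫ - ℓ)⁻¹ • π (x - a) with hy
  obtain ⟨x₀, ⟨hx₀V, hx₀⟩, hmax⟩ : ∃ x₀ ∈ {x ∈ V | ℓ < ⟪u, x⟫}, ∀ x ∈ {x ∈ V | ℓ < ⟪u, x⟫},
      ‖y x‖ ≤ ‖y x₀‖ := by
    refine Set.exists_max_image _ _ (hV.subset (Set.sep_subset _ _)) ?_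
    by_contra hemp
    rw [Set.not_nonempty_iff_eq_empty] at hemp
    refine hproper ?_
    rw [hF, zeroFace_convexHull hl]
    congr 1
    ext x
    refine ⟨fun h => h.1, fun hx => ⟨hx, ?_⟩⟩
    by_contra hne
    have : x ∈ ({x ∈ V | ℓ < ⟪u, x⟫} : Set E) := ⟨hx, lt_of_le_of_ne (hl x hx) (Ne.symm hne)⟩
    rw [hemp] at this
    exact this
  set z := y x₀ with hz
  have hzW : z ∈ Wᗮ := Submodule.smul_mem _ _ (Submodule.starProjection_apply_mem _ _)
  have hFW : ∀ x ∈ F, x - a ∈ W := fun x hx => vsub_mem_vectorSpan ℝ hx ha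
  have hzF : ∀ x ∈ F, ⟪z, x - a⟫ = 0 := fun x hx =>
    Submodule.inner_left_of_mem_orthogonal (hFW x hx) hzW
  have hzpr : ∀ x, ⟪z, x - a⟫ = ⟪z, π (x - a)⟫ := by
    intro x
    have := Submodule.starProjection_inner_eq_zero (K := Wᗮ) (x - a) z hzW
    rw [real_inner_comm, inner_sub_right] at this
    linarith
  have hy' : ∀ x, ℓ < ⟪u, x⟫ → π (x - a) = (⟪u, x⟫ - ℓ) • y x := by
    intro x hx
    have : ⟪u, x⟫ - ℓ ≠ 0 := by linarith
    rw [hy, smul_inv_smul₀ this]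
  -- the value at `x` of the new functional
  have hval : ∀ x, ⟪‖z‖ ^ 2 • u - z, x⟫ - (‖z‖ ^ 2 * ℓ - ⟪z, a⟫) =
      ‖z‖ ^ 2 * (⟪u, x⟫ - ℓ) - ⟪z, x - a⟫ := by
    intro x
    rw [inner_sub_left, real_inner_smul_left, inner_sub_right]
    ring
  have hval0 : ∀ x ∈ F, ⟪‖z‖ ^ 2 • u - z, x⟫ - (‖z‖ ^ 2 * ℓ - ⟪z, a⟫) = 0 := by
    intro x hx
    rw [hval, hzF x hx, hx.2]
    ring
  have hval1 : ∀ x, ℓ < ⟪u, x⟫ → ⟪‖z‖ ^ 2 • u - z, x⟫ - (‖z‖ ^ 2 * ℓ - ⟪z, a⟫) =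
      (⟪u, x⟫ - ℓ) * (‖z‖ ^ 2 - ⟪z, y x⟫) := by
    intro x hx
    rw [hval, hzpr, hy' x hx, real_inner_smul_right]
    ring
  have hnorm : ∀ x ∈ V, ℓ < ⟪u, x⟫ → ‖z - y x‖ ^ 2 ≤ 2 * (‖z‖ ^ 2 - ⟪z, y x⟫) := by
    intro x hxV hx
    have h1 := hmax x ⟨hxV, hx⟩
    have h2 := norm_nonneg (y x)
    rw [norm_sub_sq_real]
    nlinarith
  have hVF : ∀ x ∈ V, ¬ ℓ < ⟪u, x⟫ → x ∈ F := fun x hx h =>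
    ⟨subset_convexHull ℝ _ hx, le_antisymm (not_lt.1 h) (hl x hx)⟩
  have hpos : ∀ x ∈ V, ‖z‖ ^ 2 * ℓ - ⟪z, a⟫ ≤ ⟪‖z‖ ^ 2 • u - z, x⟫ := by
    intro x hx
    by_cases hxl : ℓ < ⟪u, x⟫
    · have h1 := hval1 x hxl
      have h2 := hnorm x hx hxl
      have h3 := sq_nonneg ‖z - y x‖
      have h4 : 0 ≤ (⟪u, x⟫ - ℓ) * (‖z‖ ^ 2 - ⟪z, y x⟫) :=
        mul_nonneg (by linarith) (by linarith)
      linarith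
    · linarith [hval0 x (hVF x hx hxl)]
  refine ⟨‖z‖ ^ 2 • u - z, ‖z‖ ^ 2 * ℓ - ⟪z, a⟫, le_inner_of_mem_convexHull hpos,
    fun x hx => ⟨hx.1, by linarith [hval0 x hx]⟩, ?_⟩
  set G := zeroFace (convexHull ℝ V) (‖z‖ ^ 2 • u - z) (‖z‖ ^ 2 * ℓ - ⟪z, a⟫) with hG
  have hFG : F ⊆ G := fun x hx => ⟨hx.1, by linarith [hval0 x hx]⟩
  have hx₀G : x₀ ∈ G := by
    refine ⟨subset_convexHull ℝ _ hx₀V, ?_⟩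
    have h1 := hval1 x₀ hx₀
    rw [← hz, real_inner_self_eq_norm_sq] at h1
    linarith
  have hx₀W : x₀ - a ∉ W := by
    intro h
    have h0 : ∀ w ∈ W, ⟪u, w⟫ = 0 := by
      intro w hw
      have h1 : w +ᵥ a ∈ affineSpan ℝ F := by
        refine AffineSubspace.vadd_mem_of_mem_direction ?_ (subset_affineSpan ℝ _ ha)
        rwa [direction_affineSpan]
      have h2 := inner_eq_of_mem_affineSpan (fun x (hx : x ∈ F) => hx.2) h1
      rw [vadd_eq_add, inner_add_right, ha.2] at h2
      linarith
    have h1 := h0 _ h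
    rw [inner_sub_right, ha.2] at h1
    linarith
  have hGM : ∀ x ∈ G, x - a ∈ W ⊔ ℝ ∙ (x₀ - a) := by
    intro x hx
    rw [hG, zeroFace_convexHull hpos] at hx
    have hconv : Convex ℝ (AffineSubspace.mk' a (W ⊔ ℝ ∙ (x₀ - a)) : Set E) :=
      AffineSubspace.convex _
    have := convexHull_min (t := (AffineSubspace.mk' a (W ⊔ ℝ ∙ (x₀ - a)) : Set E)) ?_ hconv hx
    · simpa [AffineSubspace.mem_mk'] using this
    · rintro x ⟨hxV, hx⟩
      simp only [SetLike.mem_coe, AffineSubspace.mem_mk', vsub_eq_sub]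
      by_cases hxl : ℓ < ⟪u, x⟫
      · have h1 := hval1 x hxl
        have h2 := hnorm x hxV hxl
        have h3 : ‖z‖ ^ 2 - ⟪z, y x⟫ = 0 := by
          have : (⟪u, x⟫ - ℓ) * (‖z‖ ^ 2 - ⟪z, y x⟫) = 0 := by linarith
          rcases mul_eq_zero.1 this with h | h
          · linarith
          · exact h
        have h4 : z - y x = 0 := by
          rw [← norm_eq_zero]
          have := norm_nonneg (z - y x)
          nlinarith
        have h5 : y x = z := (sub_eq_zero.1 h4).symm
        set c := (⟪u, x⟫ - ℓ) / (⟪u, x₀⟫ - ℓ) with hc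
        have hc' : c * (⟪u, x₀⟫ - ℓ) = ⟪u, x⟫ - ℓ :=
          div_mul_cancel₀ _ (by linarith)
        have h6 : π ((x - a) - c • (x₀ - a)) = 0 := by
          rw [map_sub, map_smul, hy' x hxl, hy' x₀ hx₀, h5, smul_smul c _ z, hc', sub_self]
        have h7 : (x - a) - c • (x₀ - a) ∈ W := by
          rw [hπ, Submodule.starProjection_apply_eq_zero_iff,
            Submodule.orthogonal_orthogonal] at h6
          exact h6
        rw [← sub_add_cancel (x - a) (c • (x₀ - a))]
        exact Submodule.add_mem_sup h7 (Submodule.smul_mem _ _ (Submodule.mem_span_singleton_self _))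
      · exact Submodule.mem_sup_left (hFW x (hVF x hxV hxl))
  have hspan : vectorSpan ℝ G = W ⊔ ℝ ∙ (x₀ - a) := by
    apply le_antisymm
    · rw [vectorSpan_eq_span_vsub_set_right ℝ (hFG ha), Submodule.span_le]
      rintro _ ⟨x, hx, rfl⟩
      exact hGM x hx
    · refine sup_le (vectorSpan_mono ℝ hFG) ?_
      rw [Submodule.span_singleton_le_iff_mem]
      exact vsub_mem_vectorSpan ℝ hx₀G (hFG ha)
  rw [hspan, Submodule.finrank_sup_span_singleton hx₀W]

/-- A face of a face of a polytope is a face of the polytope: add a large multiple of the functional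
that exposes the larger face. -/
theorem exists_zeroFace_zeroFace_eq {V : Set E} (hV : V.Finite) {u w : E} {ℓ m : ℝ}
    (hl : ∀ x ∈ V, ℓ ≤ ⟪u, x⟫) (hm : ∀ x ∈ zeroFace V u ℓ, m ≤ ⟪w, x⟫) :
    ∃ (u' : E) (ℓ' : ℝ), (∀ x ∈ convexHull ℝ V, ℓ' ≤ ⟪u', x⟫) ∧
      zeroFace (zeroFace (convexHull ℝ V) u ℓ) w m = zeroFace (convexHull ℝ V) u' ℓ' := by
  obtain ⟨N, hN⟩ := (hV.image fun x => (m - ⟪w, x⟫) / (⟪u, x⟫ - ℓ)).bddAbove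
  have hval : ∀ x, ⟪w + (N + 1) • u, x⟫ - (m + (N + 1) * ℓ) =
      (⟪w, x⟫ - m) + (N + 1) * (⟪u, x⟫ - ℓ) := by
    intro x
    rw [inner_add_left, real_inner_smul_left]
    ring
  have hpos : ∀ x ∈ V, ℓ < ⟪u, x⟫ → 0 < (⟪w, x⟫ - m) + (N + 1) * (⟪u, x⟫ - ℓ) := by
    intro x hx hxl
    have h1 : (m - ⟪w, x⟫) / (⟪u, x⟫ - ℓ) ≤ N := hN ⟨x, hx, rfl⟩
    rw [div_le_iff₀ (by linarith)] at h1
    linarith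
  have hnn : ∀ x ∈ V, m + (N + 1) * ℓ ≤ ⟪w + (N + 1) • u, x⟫ := by
    intro x hx
    rcases (hl x hx).eq_or_lt with h | h
    · have h1 := hval x
      have h2 := hm x ⟨hx, h.symm⟩
      rw [← h, sub_self, mul_zero] at h1
      linarith
    · linarith [hval x, hpos x hx h]
  refine ⟨_, _, le_inner_of_mem_convexHull hnn, ?_⟩
  rw [zeroFace_convexHull hl, zeroFace_convexHull hm, zeroFace_convexHull hnn]
  congr 1
  ext x
  constructor
  · rintro ⟨⟨hx, h1⟩, h2⟩
    refine ⟨hx, ?_⟩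
    have := hval x
    rw [h1, h2, sub_self, sub_self, mul_zero, add_zero] at this
    linarith
  · rintro ⟨hx, h1⟩
    have h2 := hval x
    rcases (hl x hx).eq_or_lt with h | h
    · refine ⟨⟨hx, h.symm⟩, ?_⟩
      rw [← h, sub_self, mul_zero] at h2
      linarith
    · linarith [hpos x hx h]

/-- The functional exposing a proper face `R` can be rotated about `R` away from a proper face
`S ⊇ R`, until the face it exposes gains a vertex outside `S`. -/
theorem exists_zeroFace_inter_eq {V : Set E} (hV : V.Finite) {u w : E} {ℓ m : ℝ}
    (hl : ∀ x ∈ V, ℓ ≤ ⟪u, x⟫) (hm : ∀ x ∈ V, m ≤ ⟪w, x⟫)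
    (hRS : zeroFace (convexHull ℝ V) w m ⊆ zeroFace (convexHull ℝ V) u ℓ)
    (hproper : zeroFace (convexHull ℝ V) u ℓ ≠ convexHull ℝ V) :
    ∃ (u' : E) (ℓ' : ℝ), (∀ x ∈ convexHull ℝ V, ℓ' ≤ ⟪u', x⟫) ∧
      zeroFace (convexHull ℝ V) u ℓ ∩ zeroFace (convexHull ℝ V) u' ℓ' =
        zeroFace (convexHull ℝ V) w m ∧
      ∃ x ∈ zeroFace (convexHull ℝ V) u' ℓ', x ∉ zeroFace (convexHull ℝ V) u ℓ := by
  obtain ⟨x₀, ⟨hx₀V, hx₀⟩, hmin⟩ : ∃ x₀ ∈ {x ∈ V | ℓ < ⟪u, x⟫}, ∀ x ∈ {x ∈ V | ℓ < ⟪u, x⟫},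
      (⟪w, x₀⟫ - m) / (⟪u, x₀⟫ - ℓ) ≤ (⟪w, x⟫ - m) / (⟪u, x⟫ - ℓ) := by
    refine Set.exists_min_image _ _ (hV.subset (Set.sep_subset _ _)) ?_
    by_contra hemp
    rw [Set.not_nonempty_iff_eq_empty] at hemp
    refine hproper ?_
    rw [zeroFace_convexHull hl]
    congr 1
    ext x
    refine ⟨fun h => h.1, fun hx => ⟨hx, ?_⟩⟩
    by_contra hne
    have : x ∈ ({x ∈ V | ℓ < ⟪u, x⟫} : Set E) := ⟨hx, lt_of_le_of_ne (hl x hx) (Ne.symm hne)⟩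
    rw [hemp] at this
    exact this
  set t := (⟪w, x₀⟫ - m) / (⟪u, x₀⟫ - ℓ) with ht
  have ht₀ : t * (⟪u, x₀⟫ - ℓ) = ⟪w, x₀⟫ - m := div_mul_cancel₀ _ (by linarith)
  have hval : ∀ x, ⟪w - t • u, x⟫ - (m - t * ℓ) = (⟪w, x⟫ - m) - t * (⟪u, x⟫ - ℓ) := by
    intro x
    rw [inner_sub_left, real_inner_smul_left]
    ring
  have hnn : ∀ x ∈ V, m - t * ℓ ≤ ⟪w - t • u, x⟫ := by
    intro x hx
    have h1 := hval x
    rcases (hl x hx).eq_or_lt with h | h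
    · rw [← h, sub_self, mul_zero] at h1
      linarith [hm x hx]
    · have h2 := hmin x ⟨hx, h⟩
      rw [le_div_iff₀ (by linarith)] at h2
      linarith
  refine ⟨w - t • u, m - t * ℓ, le_inner_of_mem_convexHull hnn, ?_, x₀,
    ⟨subset_convexHull ℝ _ hx₀V, by linarith [hval x₀]⟩, fun h => hx₀.ne' h.2⟩
  ext x
  have h1 := hval x
  constructor
  · rintro ⟨⟨hx, h2⟩, -, h3⟩
    rw [h2, h3] at h1
    exact ⟨hx, by linarith⟩
  · intro hx
    have h2 := hRS hx
    rw [h2.2, hx.2] at h1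
    exact ⟨h2, hx.1, by linarith⟩

end

/-! ### Faces of simplices -/

section
variable {E : Type*} [NormedAddCommGroup E] [InnerProductSpace ℝ E]

/-- Every nonempty set of vertices of a simplex spans a face: some affine functional vanishes on it
and equals one at the other vertices. -/
theorem AffineIndependent.exists_inner_eq [FiniteDimensional ℝ E] {ι : Type*} {w : ι → E}
    (hw : AffineIndependent ℝ w) {T : Set ι} (hT : T.Nonempty) :
    ∃ (q : E) (c : ℝ), (∀ i ∈ T, ⟪q, w i⟫ = c) ∧ ∀ i ∉ T, ⟪q, w i⟫ = c + 1 := by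
  classical
  obtain ⟨t, ht⟩ := hT
  have hli := (affineIndependent_iff_linearIndependent_vsub ℝ w t).1 hw
  set b := Module.Basis.sumExtend hli with hb
  set f : E →ₗ[ℝ] ℝ := b.constr ℝ (Sum.elim (fun i => if (i : ι) ∈ T then 0 else 1) 0) with hf
  have hfi : ∀ i : {x // x ≠ t}, f (w i - w t) = if (i : ι) ∈ T then 0 else 1 := by
    intro i
    have h1 : b (Sum.inl i) = w i - w t := by
      rw [hb, Module.Basis.sumExtend, Module.Basis.reindex_apply, Module.Basis.extend_apply_self]
      rfl
    rw [← h1, hf, Module.Basis.constr_basis]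
    rfl
  refine ⟨(InnerProductSpace.toDual ℝ E).symm (LinearMap.toContinuousLinearMap f), f (w t), ?_, ?_⟩
  · intro i hi
    rw [InnerProductSpace.toDual_symm_apply, LinearMap.coe_toContinuousLinearMap']
    by_cases hit : i = t
    · rw [hit]
    · have := hfi ⟨i, hit⟩
      rw [map_sub, if_pos hi] at this
      linarith
  · intro i hi
    rw [InnerProductSpace.toDual_symm_apply, LinearMap.coe_toContinuousLinearMap']
    have := hfi ⟨i, fun h => hi (h ▸ ht)⟩
    rw [map_sub, if_neg hi] at this
    linarith

theorem zeroFace_convexHull_range {ι : Type*} {w : ι → E} {u : E} {ℓ : ℝ}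
    (h : ∀ i, ℓ ≤ ⟪u, w i⟫) :
    zeroFace (convexHull ℝ (Set.range w)) u ℓ = convexHull ℝ (w '' {i | ⟪u, w i⟫ = ℓ}) := by
  rw [zeroFace_convexHull (by rintro _ ⟨i, rfl⟩; exact h i)]
  congr 1
  ext x
  constructor
  · rintro ⟨⟨i, rfl⟩, hi⟩
    exact ⟨i, hi, rfl⟩
  · rintro ⟨i, hi, rfl⟩
    exact ⟨⟨i, rfl⟩, hi⟩

theorem AffineIndependent.finrank_vectorSpan_convexHull_image {ι : Type*} {w : ι → E}
    (hw : AffineIndependent ℝ w) {T : Finset ι} {n : ℕ} (hT : T.card = n + 1) :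
    Module.finrank ℝ (vectorSpan ℝ (convexHull ℝ (w '' T))) = n := by
  classical
  rw [vectorSpan_convexHull, ← Finset.coe_image]
  exact hw.finrank_vectorSpan_image_finset hT

end

variable {d : ℕ}

theorem IsSimplexOfDim.finrank_vectorSpan {m : ℕ} {F : Set (EucSpace d)}
    (h : IsSimplexOfDim m F) : Module.finrank ℝ (vectorSpan ℝ F) = m := by
  obtain ⟨s, rfl⟩ := h
  rw [vectorSpan_convexHull]
  exact s.independent.finrank_vectorSpan (by simp)

theorem isSimplexOfDim_convexHull_image {ι : Type*} {w : ι → EucSpace d}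
    (hw : AffineIndependent ℝ w) {T : Finset ι} {n : ℕ} (hT : T.card = n + 1) :
    IsSimplexOfDim n (convexHull ℝ (w '' T)) := by
  let e : Fin (n + 1) ≃ T := (T.equivFinOfCardEq hT).symm
  refine ⟨⟨fun i => w (e i), hw.comp_embedding
    (e.toEmbedding.trans (Function.Embedding.subtype _))⟩, ?_⟩
  congr 1
  ext x
  constructor
  · rintro ⟨i, hi, rfl⟩
    exact ⟨e.symm ⟨i, hi⟩, by simp⟩
  · rintro ⟨j, rfl⟩
    exact ⟨e j, (e j).2, rfl⟩

/-- Every nonempty face of a simplex is a simplex. -/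
theorem IsSimplexOfDim.zeroFace {m n : ℕ} {K : Set (EucSpace d)} (hK : IsSimplexOfDim m K)
    {u : EucSpace d} {ℓ : ℝ} (hl : ∀ x ∈ K, ℓ ≤ ⟪u, x⟫) (hne : (zeroFace K u ℓ).Nonempty)
    (hn : Module.finrank ℝ (vectorSpan ℝ (zeroFace K u ℓ)) = n) :
    IsSimplexOfDim n (zeroFace K u ℓ) := by
  classical
  obtain ⟨s, rfl⟩ := hK
  have hface := zeroFace_convexHull_range (w := s.points) (u := u) (ℓ := ℓ)
    fun i => hl _ (subset_convexHull ℝ _ ⟨i, rfl⟩)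
  rw [hface] at hne hn ⊢
  set T : Finset (Fin (m + 1)) := Finset.univ.filter fun i => ⟪u, s.points i⟫ = ℓ with hT
  have hTc : {i | ⟪u, s.points i⟫ = ℓ} = (T : Set (Fin (m + 1))) := by ext; simp [hT]
  rw [hTc] at hne hn ⊢
  have hT0 : 0 < T.card := by
    rw [Finset.card_pos]
    rw [convexHull_nonempty_iff] at hne
    simpa using hne
  obtain ⟨n', hn'⟩ := Nat.exists_eq_add_of_lt hT0
  rw [zero_add] at hn'
  have := s.independent.finrank_vectorSpan_convexHull_image hn'
  obtain rfl : n' = n := by rw [← this, hn]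
  exact isSimplexOfDim_convexHull_image s.independent hn'

/-- A pyramid over a simplex is a simplex. -/
theorem IsSimplexOfDim.convexHull_insert {m : ℕ} {F : Set (EucSpace d)} (hF : IsSimplexOfDim m F)
    {v : EucSpace d} (hv : v ∉ affineSpan ℝ F) :
    IsSimplexOfDim (m + 1) (convexHull ℝ (insert v F)) := by
  have hd := hF.finrank_vectorSpan
  obtain ⟨s, rfl⟩ := hF
  rw [affineSpan_convexHull] at hv
  rw [vectorSpan_convexHull] at hd
  have hr : Set.range (Fin.cons v s.points : Fin (m + 2) → EucSpace d) =
      insert v (Set.range s.points) := Fin.range_cons _ _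
  refine ⟨⟨Fin.cons v s.points, ?_⟩, ?_⟩
  · rw [affineIndependent_iff_finrank_vectorSpan_eq (n := m + 1) ℝ _ (by simp), hr,
      finrank_vectorSpan_insert_of_notMem (Set.range_nonempty _) hv, hd]
  · simp only
    rw [hr, Set.insert_eq, Set.insert_eq, convexHull_convexHull_union_right]

/-! ### Faces, facets and ridges of a `d`-polytope -/

theorem IsFaceOfDim.exists_eq_zeroFace {P F : Set (EucSpace d)} {k : ℕ} (h : IsFaceOfDim P k F) :
    ∃ (u : EucSpace d) (ℓ : ℝ), (∀ x ∈ P, ℓ ≤ ⟪u, x⟫) ∧ F = zeroFace P u ℓ :=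
  (isExposed_iff_exists_zeroFace h.2.1).1 h.1

theorem isFaceOfDim_zeroFace {P : Set (EucSpace d)} {u : EucSpace d} {ℓ : ℝ}
    (hl : ∀ x ∈ P, ℓ ≤ ⟪u, x⟫) (hne : (zeroFace P u ℓ).Nonempty) :
    IsFaceOfDim P (Module.finrank ℝ (vectorSpan ℝ (zeroFace P u ℓ))) (zeroFace P u ℓ) :=
  ⟨(isExposed_iff_exists_zeroFace hne).2 ⟨u, ℓ, hl, rfl⟩, hne, rfl⟩

theorem IsFaceOfDim.subset {P F : Set (EucSpace d)} {k : ℕ} (h : IsFaceOfDim P k F) : F ⊆ P :=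
  h.1.subset

theorem IsFaceOfDim.inter_affineSpan {P F : Set (EucSpace d)} {k : ℕ} (h : IsFaceOfDim P k F) :
    P ∩ affineSpan ℝ F = F := by
  obtain ⟨u, ℓ, -, rfl⟩ := h.exists_eq_zeroFace
  exact inter_affineSpan_zeroFace P u ℓ

/-- A face is strictly contained only in sets of larger dimension. -/
theorem IsFaceOfDim.eq_of_subset_of_finrank_le {P F G : Set (EucSpace d)} {k : ℕ}
    (h : IsFaceOfDim P k F) (hFG : F ⊆ G) (hG : G ⊆ P)
    (hd : Module.finrank ℝ (vectorSpan ℝ G) ≤ k) : F = G := by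
  have h1 := affineSpan_eq_of_subset_of_finrank_le h.2.1 hFG (h.2.2.symm ▸ hd)
  refine hFG.antisymm fun x hx => ?_
  rw [← h.inter_affineSpan, h1]
  exact ⟨hG hx, subset_affineSpan ℝ _ hx⟩

theorem IsDPolytope.finrank_vectorSpan {P : Set (EucSpace d)} (hP : IsDPolytope P) :
    Module.finrank ℝ (vectorSpan ℝ P) = d := by
  rw [← direction_affineSpan, hP.2, AffineSubspace.direction_top, finrank_top,
    finrank_euclideanSpace_fin]

theorem IsFacet.finrank_add_one {P G : Set (EucSpace d)} (hG : IsFacet P G) :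
    Module.finrank ℝ (vectorSpan ℝ G) + 1 = d := by
  obtain ⟨m, hm, hG⟩ := hG
  rw [hG.2.2, hm]

theorem IsFacet.nonempty {P G : Set (EucSpace d)} (hG : IsFacet P G) : G.Nonempty := by
  obtain ⟨m, hm, hG⟩ := hG
  exact hG.2.1

theorem IsFacet.subset {P G : Set (EucSpace d)} (hG : IsFacet P G) : G ⊆ P := by
  obtain ⟨m, hm, hG⟩ := hG
  exact hG.subset

theorem IsFacet.inter_affineSpan {P G : Set (EucSpace d)} (hG : IsFacet P G) :
    P ∩ affineSpan ℝ G = G := by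
  obtain ⟨m, hm, hG⟩ := hG
  exact hG.inter_affineSpan

theorem IsFacet.ne_self {P G : Set (EucSpace d)} (hP : IsDPolytope P) (hG : IsFacet P G) :
    G ≠ P := by
  rintro rfl
  have := hG.finrank_add_one
  rw [hP.finrank_vectorSpan] at this
  omega

theorem IsFacet.exists_normal {P G : Set (EucSpace d)} (hP : IsDPolytope P) (hG : IsFacet P G) :
    ∃ (u : EucSpace d) (ℓ : ℝ), IsInnerNormal P G u ℓ ∧ G = zeroFace P u ℓ := by
  have hne := hG.ne_self hP
  obtain ⟨m, hm, hG⟩ := hG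
  obtain ⟨u, ℓ, hl, he⟩ := hG.exists_eq_zeroFace
  refine ⟨u, ℓ, ⟨?_, fun y hy => ?_, hl⟩, he⟩
  · rintro rfl
    obtain ⟨a, ha⟩ := hG.2.1
    rw [he] at ha
    refine hne (he.trans (Set.sep_eq_self_iff_mem_true.2 fun x _ => ?_))
    rw [← ha.2, inner_zero_left, inner_zero_left]
  · rw [he] at hy
    exact hy.2

theorem IsFacet.affineSpan_eq {P G : Set (EucSpace d)} (hG : IsFacet P G)
    {u : EucSpace d} {ℓ : ℝ} (hu : u ≠ 0) (hl : ∀ y ∈ G, ⟪u, y⟫ = ℓ) :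
    (affineSpan ℝ G : Set (EucSpace d)) = {x | ⟪u, x⟫ = ℓ} := by
  refine Set.Subset.antisymm (fun x hx => inner_eq_of_mem_affineSpan hl hx) fun x hx => ?_
  have hdir : vectorSpan ℝ G = (ℝ ∙ u)ᗮ := by
    refine Submodule.eq_of_le_of_finrank_eq ?_ ?_
    · rw [vectorSpan_def, Submodule.span_le]
      rintro _ ⟨y, hy, z, hz, rfl⟩
      simp only [vsub_eq_sub]
      rw [SetLike.mem_coe, Submodule.mem_orthogonal_singleton_iff_inner_right,
        inner_sub_right, hl y hy, hl z hz, sub_self]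
    · have h1 := hG.finrank_add_one
      have h2 := Submodule.finrank_add_finrank_orthogonal (ℝ ∙ u)
      rw [finrank_span_singleton hu, finrank_euclideanSpace_fin] at h2
      omega
  obtain ⟨a, ha⟩ := hG.nonempty
  have h1 : x - a ∈ (affineSpan ℝ G).direction := by
    rw [direction_affineSpan, hdir, Submodule.mem_orthogonal_singleton_iff_inner_right,
      inner_sub_right, hl a ha, sub_eq_zero]
    exact hx
  simpa using AffineSubspace.vadd_mem_of_mem_direction h1 (subset_affineSpan ℝ _ ha)

theorem IsFacet.eq_of_subset_hyperplane {P G G' : Set (EucSpace d)} (hG : IsFacet P G)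
    (hG' : IsFacet P G') {u : EucSpace d} {ℓ : ℝ} (hu : u ≠ 0) (hl : ∀ y ∈ G, ⟪u, y⟫ = ℓ)
    (hl' : ∀ y ∈ G', ⟪u, y⟫ = ℓ) : G = G' := by
  rw [← hG.inter_affineSpan, ← hG'.inter_affineSpan, hG.affineSpan_eq hu hl,
    hG'.affineSpan_eq hu hl']

theorem IsDPolytope.finite_setOf_isFacet {P : Set (EucSpace d)} (hP : IsDPolytope P) :
    {G | IsFacet P G}.Finite := by
  obtain ⟨⟨V, hV, rfl⟩, -⟩ := hP
  refine (hV.finite_subsets.image (convexHull ℝ)).subset ?_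
  rintro G ⟨m, -, hG⟩
  obtain ⟨u, ℓ, hl, rfl⟩ := hG.exists_eq_zeroFace
  refine ⟨zeroFace V u ℓ, Set.sep_subset _ _, ?_⟩
  rw [zeroFace_convexHull fun x hx => hl x (subset_convexHull ℝ V hx)]

theorem IsFaceOfDim.exists_superset {P F : Set (EucSpace d)} (hP : IsDPolytope P) {m n : ℕ}
    (hF : IsFaceOfDim P m F) (hmn : m ≤ n) (hn : n ≤ d) : ∃ K, IsFaceOfDim P n K ∧ F ⊆ K := by
  induction n, hmn using Nat.le_induction with
  | base => exact ⟨F, hF, subset_rfl⟩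
  | succ n _ ih =>
    obtain ⟨K, hK, hFK⟩ := ih (by omega)
    have hd := hP.finrank_vectorSpan
    obtain ⟨⟨V, hV, rfl⟩, -⟩ := hP
    obtain ⟨u, ℓ, hl, rfl⟩ := hK.exists_eq_zeroFace
    obtain ⟨u', ℓ', hl', hsub, hdim⟩ := exists_zeroFace_finrank_succ hV
      (fun x hx => hl x (subset_convexHull ℝ V hx)) hK.2.1 (by
        intro h
        have := hK.2.2
        rw [h] at this
        omega)
    refine ⟨_, ?_, hFK.trans hsub⟩
    have := isFaceOfDim_zeroFace hl' (hK.2.1.mono hsub)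
    rwa [hdim, hK.2.2] at this

/-- A ridge contained in a facet `S` is the intersection of `S` with another facet. -/
theorem IsRidge.exists_facet_inter_eq {P R S : Set (EucSpace d)} (hP : IsDPolytope P)
    (hR : IsRidge P R) (hS : IsFacet P S) (hRS : R ⊆ S) : ∃ G, IsFacet P G ∧ S ∩ G = R := by
  have hd := hP.finrank_vectorSpan
  have hSP := hS.ne_self hP
  have hSd := hS.finrank_add_one
  obtain ⟨n, hn, hS⟩ := hS
  obtain ⟨m, hm, hR⟩ := hR
  obtain ⟨⟨V, hV, rfl⟩, -⟩ := hP
  obtain ⟨u, ℓ, hl, rfl⟩ := hS.exists_eq_zeroFace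
  obtain ⟨w, c, hc, rfl⟩ := hR.exists_eq_zeroFace
  obtain ⟨u', ℓ', hl', hinter, x, hx, hxS⟩ := exists_zeroFace_inter_eq hV
    (fun x hx => hl x (subset_convexHull ℝ V hx)) (fun x hx => hc x (subset_convexHull ℝ V hx))
    hRS hSP
  have hRG : zeroFace (convexHull ℝ V) w c ⊆ zeroFace (convexHull ℝ V) u' ℓ' := by
    rw [← hinter]
    exact Set.inter_subset_right
  have hG := isFaceOfDim_zeroFace hl' (hR.2.1.mono hRG)
  refine ⟨_, ⟨_, ?_, hG⟩, hinter⟩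
  have h1 : m < Module.finrank ℝ (vectorSpan ℝ (zeroFace (convexHull ℝ V) u' ℓ')) := by
    by_contra hlt
    have := hR.eq_of_subset_of_finrank_le hRG hG.subset (not_lt.1 hlt)
    exact hxS (hRS (this ▸ hx))
  have h2 : Module.finrank ℝ (vectorSpan ℝ (zeroFace (convexHull ℝ V) u' ℓ')) < d := by
    by_contra hlt
    have := hG.eq_of_subset_of_finrank_le hG.subset subset_rfl (by omega)
    rw [this, Set.inter_eq_left.2 hS.subset] at hinter
    rw [hinter, hR.2.2] at hSd
    omega
  omega

variable {m : ℕ}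

/-! ### Faces of a simplex facet and its adjacent facets -/

theorem IsDPolytope.convex {P : Set (EucSpace d)} (hP : IsDPolytope P) : Convex ℝ P := by
  obtain ⟨⟨V, -, rfl⟩, -⟩ := hP
  exact convex_convexHull ℝ V

theorem IsFacet.convex {P G : Set (EucSpace d)} (hP : IsDPolytope P) (hG : IsFacet P G) :
    Convex ℝ G := by
  obtain ⟨n, -, hG⟩ := hG
  exact hG.1.convex hP.convex

/-- Any nonempty set of vertices of a simplex facet spans a face of the polytope. -/
theorem isFaceOfDim_convexHull_image {P S : Set (EucSpace d)} (hP : IsDPolytope P)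
    (hS : IsFacet P S) {w : Fin (m + 1) → EucSpace d} (hw : AffineIndependent ℝ w)
    (hSw : S = convexHull ℝ (Set.range w)) {T : Finset (Fin (m + 1))} {n : ℕ}
    (hT : T.card = n + 1) : IsFaceOfDim P n (convexHull ℝ (w '' T)) := by
  have hTne : T.Nonempty := Finset.card_pos.1 (by omega)
  obtain ⟨q, c, hq, hq'⟩ := hw.exists_inner_eq (T := (T : Set (Fin (m + 1)))) (by simpa using hTne)
  have hqc : ∀ i, c ≤ ⟪q, w i⟫ := by
    intro i
    by_cases hi : i ∈ T
    · exact (hq i hi).ge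
    · linarith [hq' i hi]
  have hTc : {i | ⟪q, w i⟫ = c} = (T : Set (Fin (m + 1))) := by
    ext i
    refine ⟨fun h => ?_, hq i⟩
    by_contra hi
    have h1 : ⟪q, w i⟫ = c := h
    linarith [hq' i hi]
  have hface := zeroFace_convexHull_range hqc
  rw [hTc, ← hSw] at hface
  have hSq : ∀ x ∈ S, c ≤ ⟪q, x⟫ := by
    rw [hSw]
    exact le_inner_of_mem_convexHull (by rintro _ ⟨i, rfl⟩; exact hqc i)
  obtain ⟨n', -, hS⟩ := hS
  obtain ⟨⟨V, hV, rfl⟩, -⟩ := hP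
  obtain ⟨u, ℓ, hl, hSu⟩ := hS.exists_eq_zeroFace
  obtain ⟨u', ℓ', hl', he⟩ := exists_zeroFace_zeroFace_eq hV (w := q) (m := c)
    (fun x hx => hl x (subset_convexHull ℝ V hx))
    (fun x hx => hSq x (hSu ▸ ⟨subset_convexHull ℝ V hx.1, hx.2⟩))
  rw [← hSu, hface] at he
  have hne : (convexHull ℝ (w '' (T : Set (Fin (m + 1))))).Nonempty := by
    simpa [convexHull_nonempty_iff] using hTne
  have := isFaceOfDim_zeroFace hl' (he ▸ hne)
  rwa [← he, hw.finrank_vectorSpan_convexHull_image hT] at this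

/-- A facet adjacent to a simplex facet contains all of its vertices but one. -/
theorem exists_forall_mem_iff_ne {P S G : Set (EucSpace d)} (hP : IsDPolytope P)
    (hmd : m + 1 = d) (hS : IsFacet P S) {w : Fin (m + 1) → EucSpace d}
    (hw : AffineIndependent ℝ w) (hSw : S = convexHull ℝ (Set.range w))
    (hG : G ∈ adjFacets P S) : ∃ i, ∀ j, w j ∈ G ↔ j ≠ i := by
  classical
  have hwS : ∀ j, w j ∈ S := fun j => hSw ▸ subset_convexHull ℝ _ ⟨j, rfl⟩
  obtain ⟨hGf, r, hr, hR⟩ := hG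
  obtain ⟨u, ℓ, hu, hGu⟩ := hGf.exists_normal hP
  have hmem : ∀ j, w j ∈ G ↔ ⟪u, w j⟫ = ℓ := by
    intro j
    rw [hGu]
    exact ⟨fun h => h.2, fun h => ⟨hS.subset (hwS j), h⟩⟩
  have hSG : S ∩ G = zeroFace S u ℓ := by
    ext x
    rw [hGu]
    exact ⟨fun h => ⟨h.1, h.2.2⟩, fun h => ⟨h.1, hS.subset h.1, h.2⟩⟩
  have hface := zeroFace_convexHull_range (w := w) (u := u) (ℓ := ℓ)
    fun j => hu.2.2 _ (hS.subset (hwS j))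
  set T : Finset (Fin (m + 1)) := Finset.univ.filter fun j => ⟪u, w j⟫ = ℓ with hT
  have hTc : {j | ⟪u, w j⟫ = ℓ} = (T : Set (Fin (m + 1))) := by ext; simp [hT]
  rw [← hSw, ← hSG, hTc] at hface
  have hTne : 0 < T.card := by
    have := hR.2.1
    rw [hface, convexHull_nonempty_iff] at this
    rw [Finset.card_pos]
    simpa using this
  obtain ⟨n, hn⟩ := Nat.exists_eq_add_of_lt hTne
  rw [zero_add] at hn
  have h1 := hw.finrank_vectorSpan_convexHull_image hn
  rw [← hface, hR.2.2] at h1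
  have h2 : Tᶜ.card = 1 := by
    rw [Finset.card_compl, Fintype.card_fin]
    omega
  obtain ⟨i, hi⟩ := Finset.card_eq_one.1 h2
  refine ⟨i, fun j => ?_⟩
  have h3 : j ∈ Tᶜ ↔ j = i := by rw [hi, Finset.mem_singleton]
  have h4 : j ∈ T ↔ ⟪u, w j⟫ = ℓ := by simp [hT]
  rw [hmem, ← h4, ← not_iff_not, ← Finset.mem_compl, h3, not_not]

theorem exists_adjFacet_forall_mem_iff_ne {P S : Set (EucSpace d)} (hP : IsDPolytope P)
    (hm : 1 ≤ m) (hmd : m + 1 = d) (hS : IsFacet P S) {w : Fin (m + 1) → EucSpace d}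
    (hw : AffineIndependent ℝ w) (hSw : S = convexHull ℝ (Set.range w)) (i : Fin (m + 1)) :
    ∃ G ∈ adjFacets P S, ∀ j, w j ∈ G ↔ j ≠ i := by
  classical
  have hcard : ({i}ᶜ : Finset (Fin (m + 1))).card = (m - 1) + 1 := by
    rw [Finset.card_compl, Fintype.card_fin, Finset.card_singleton]
    omega
  have hR : IsRidge P (convexHull ℝ (w '' (({i}ᶜ : Finset (Fin (m + 1))) : Set (Fin (m + 1))))) :=
    ⟨m - 1, by omega, isFaceOfDim_convexHull_image hP hS hw hSw hcard⟩
  obtain ⟨G, hG, hSG⟩ := hR.exists_facet_inter_eq hP hS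
    (hSw ▸ convexHull_mono (Set.image_subset_range _ _))
  have hadj : G ∈ adjFacets P S := ⟨hG, hSG ▸ hR⟩
  obtain ⟨i', hi'⟩ := exists_forall_mem_iff_ne hP hmd hS hw hSw hadj
  have hii : i' = i := by
    by_contra hne
    have h1 : w i' ∈ S ∩ G := by
      rw [hSG]
      exact subset_convexHull ℝ _ ⟨i', by simpa using hne, rfl⟩
    exact (hi' i').1 h1.2 rfl
  exact ⟨G, hadj, hii ▸ hi'⟩

/-! ### The apex of a simplex facet in bounded position -/

/-- Each point is an affine combination of the apex and the base vertices of a simplex whose side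
hyperplanes are `⟪u i, ·⟫ = ℓ i`. -/
theorem exists_eq_add_sum_smul {E ι : Type*} [NormedAddCommGroup E] [InnerProductSpace ℝ E]
    [FiniteDimensional ℝ E] [Fintype ι] (hι : Fintype.card ι = Module.finrank ℝ E) {p : E}
    {w u : ι → E} {ℓ : ι → ℝ} (hp : ∀ i, ⟪u i, p⟫ = ℓ i) (hw : ∀ i j, j ≠ i → ⟪u i, w j⟫ = ℓ i)
    (hw' : ∀ i, ℓ i < ⟪u i, w i⟫) (x : E) : ∃ c : ι → ℝ, x = p + ∑ i, c i • (w i - p) := by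
  have hdual : ∀ (c : ι → ℝ) i, ⟪u i, ∑ j, c j • (w j - p)⟫ = c i * (⟪u i, w i⟫ - ℓ i) := by
    intro c i
    rw [inner_sum, Finset.sum_eq_single i]
    · rw [real_inner_smul_right, inner_sub_right, hp]
    · intro j _ hj
      rw [real_inner_smul_right, inner_sub_right, hp, hw i j hj, sub_self, mul_zero]
    · simp
  have hli : LinearIndependent ℝ fun i => w i - p := by
    rw [Fintype.linearIndependent_iff]
    intro c hc i
    have h1 := hdual c i
    rw [hc, inner_zero_right] at h1
    rcases mul_eq_zero.1 h1.symm with h | h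
    · exact h
    · linarith [hw' i]
  have hspan := hli.span_eq_top_of_card_eq_finrank' hι
  have hx : x - p ∈ Submodule.span ℝ (Set.range fun i => w i - p) := hspan ▸ Submodule.mem_top
  obtain ⟨c, hc⟩ := (Submodule.mem_span_range_iff_exists_fun ℝ).1 hx
  exact ⟨c, by rw [hc, add_sub_cancel]⟩

theorem inner_add_sum_smul_sub {E ι : Type*} [NormedAddCommGroup E] [InnerProductSpace ℝ E]
    [Fintype ι] (g p : E) (w : ι → E) (c : ι → ℝ) (b : ℝ) :
    ⟪g, p + ∑ i, c i • (w i - p)⟫ - b =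
      (1 - ∑ i, c i) * (⟪g, p⟫ - b) + ∑ i, c i * (⟪g, w i⟫ - b) := by
  have h1 : ∑ i, c i * (⟪g, w i⟫ - b) =
      ∑ i, c i * (⟪g, w i⟫ - ⟪g, p⟫) + (∑ i, c i) * (⟪g, p⟫ - b) := by
    rw [Finset.sum_mul, ← Finset.sum_add_distrib]
    exact Finset.sum_congr rfl fun i _ => by ring
  rw [h1, inner_add_right, inner_sum]
  simp only [real_inner_smul_right, inner_sub_right]
  ring

/-- A simplex facet `S` with vertices `w i`, its adjacent facets `G i`, with `G i` opposite to `w i`,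
and the common point `p` of their hyperplanes, beyond `S`.  The functionals `⟪u i, ·⟫ - ℓ i` and
`⟪uS, ·⟫ - ℓS` expose `G i` and `S`. -/
structure ApexConfig (P S : Set (EucSpace d)) (w : Fin d → EucSpace d)
    (G : Fin d → Set (EucSpace d)) (u : Fin d → EucSpace d) (ℓ : Fin d → ℝ) (p : EucSpace d)
    (uS : EucSpace d) (ℓS : ℝ) : Prop where
  isFacet : IsFacet P S
  mem (i) : w i ∈ S
  isFacet_adj (i) : IsFacet P (G i)
  mem_iff (i j) : w j ∈ G i ↔ j ≠ i
  normal (i) : IsInnerNormal P (G i) (u i) (ℓ i)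
  eq_zeroFace (i) : G i = zeroFace P (u i) (ℓ i)
  inner_apex (i) : ⟪u i, p⟫ = ℓ i
  normal_base : IsInnerNormal P S uS ℓS
  inner_base_apex : ⟪uS, p⟫ < ℓS

namespace ApexConfig

variable {P S : Set (EucSpace d)} {w : Fin d → EucSpace d} {G : Fin d → Set (EucSpace d)}
  {u : Fin d → EucSpace d} {ℓ : Fin d → ℝ} {p uS : EucSpace d} {ℓS : ℝ}

theorem inner_vertex_of_ne (h : ApexConfig P S w G u ℓ p uS ℓS) {i j : Fin d} (hij : j ≠ i) :
    ⟪u i, w j⟫ = ℓ i := (h.normal i).2.1 _ ((h.mem_iff i j).2 hij)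

theorem lt_inner_vertex (h : ApexConfig P S w G u ℓ p uS ℓS) (i : Fin d) :
    ℓ i < ⟪u i, w i⟫ := by
  have hwP := h.isFacet.subset (h.mem i)
  refine lt_of_le_of_ne ((h.normal i).2.2 _ hwP) fun he => ?_
  have h1 : w i ∈ G i := by
    rw [h.eq_zeroFace i]
    exact ⟨hwP, he.symm⟩
  exact (h.mem_iff i i).1 h1 rfl

theorem exists_coords (h : ApexConfig P S w G u ℓ p uS ℓS) (x : EucSpace d) :
    ∃ c : Fin d → ℝ, x = p + ∑ i, c i • (w i - p) :=
  exists_eq_add_sum_smul (by simp) h.inner_apex (fun _ _ => h.inner_vertex_of_ne)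
    h.lt_inner_vertex x

theorem inner_sub_eq (h : ApexConfig P S w G u ℓ p uS ℓS) (c : Fin d → ℝ) (i : Fin d) :
    ⟪u i, p + ∑ j, c j • (w j - p)⟫ - ℓ i = c i * (⟪u i, w i⟫ - ℓ i) := by
  rw [inner_add_sum_smul_sub, h.inner_apex, sub_self, mul_zero, zero_add, Finset.sum_eq_single i]
  · intro j _ hj
    rw [h.inner_vertex_of_ne hj, sub_self, mul_zero]
  · simp

theorem inner_base_sub_eq (h : ApexConfig P S w G u ℓ p uS ℓS) (c : Fin d → ℝ) :
    ⟪uS, p + ∑ j, c j • (w j - p)⟫ - ℓS = (1 - ∑ i, c i) * (⟪uS, p⟫ - ℓS) := by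
  rw [inner_add_sum_smul_sub, add_eq_left]
  refine Finset.sum_eq_zero fun i _ => ?_
  rw [h.normal_base.2.1 _ (h.mem i), sub_self, mul_zero]

theorem coord_nonneg (h : ApexConfig P S w G u ℓ p uS ℓS) {c : Fin d → ℝ}
    (hx : p + ∑ i, c i • (w i - p) ∈ P) (i : Fin d) : 0 ≤ c i := by
  have h1 := h.inner_sub_eq c i
  have h2 := (h.normal i).2.2 _ hx
  have h3 := h.lt_inner_vertex i
  by_contra hc
  nlinarith

theorem one_le_sum_coord (h : ApexConfig P S w G u ℓ p uS ℓS) {c : Fin d → ℝ}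
    (hx : p + ∑ i, c i • (w i - p) ∈ P) : 1 ≤ ∑ i, c i := by
  have h1 := h.inner_base_sub_eq c
  have h2 := h.normal_base.2.2 _ hx
  have h3 := h.inner_base_apex
  by_contra hc
  nlinarith

/-- The apex is strictly beneath all facets other than `S` and the `G i`: in the coordinates with
respect to the apex and the vertices of `S`, a functional that is nonnegative at the vertices and
nonpositive at the apex is a sum of terms of one sign on `P`, so that its zero set on `P` lies in a
coordinate hyperplane. -/
theorem lt_inner_apex_of_ne (h : ApexConfig P S w G u ℓ p uS ℓS) {F : Set (EucSpace d)}
    (hF : IsFacet P F) (hFS : F ≠ S) (hFG : ∀ i, F ≠ G i) {g : EucSpace d} {b : ℝ}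
    (hg : IsInnerNormal P F g b) : b < ⟪g, p⟫ := by
  by_contra hle
  rw [not_lt] at hle
  have hgw : ∀ i, 0 ≤ ⟪g, w i⟫ - b := fun i =>
    sub_nonneg.2 (hg.2.2 _ (h.isFacet.subset (h.mem i)))
  have key : ∀ c : Fin d → ℝ, p + ∑ i, c i • (w i - p) ∈ F →
      (1 - ∑ i, c i) * (⟪g, p⟫ - b) = 0 ∧ ∀ i, c i * (⟪g, w i⟫ - b) = 0 := by
    intro c hx
    have hxP := hF.subset hx
    have h1 := inner_add_sum_smul_sub g p w c b
    rw [hg.2.1 _ hx, sub_self] at h1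
    have h2 : ∀ i ∈ Finset.univ, 0 ≤ c i * (⟪g, w i⟫ - b) := fun i _ =>
      mul_nonneg (h.coord_nonneg hxP i) (hgw i)
    have h3 : 0 ≤ (1 - ∑ i, c i) * (⟪g, p⟫ - b) :=
      mul_nonneg_of_nonpos_of_nonpos (by linarith [h.one_le_sum_coord hxP]) (by linarith)
    have h4 := Finset.sum_nonneg h2
    have h5 : ∑ i, c i * (⟪g, w i⟫ - b) = 0 := by linarith
    exact ⟨by linarith, fun i => (Finset.sum_eq_zero_iff_of_nonneg h2).1 h5 i (Finset.mem_univ i)⟩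
  have hpb : ⟪g, p⟫ = b := by
    by_contra hne
    refine hFS (hF.eq_of_subset_hyperplane h.isFacet h.normal_base.1 (fun y hy => ?_)
      h.normal_base.2.1)
    obtain ⟨c, rfl⟩ := h.exists_coords y
    have h1 := h.inner_base_sub_eq c
    rcases mul_eq_zero.1 (key c hy).1 with h2 | h2
    · rw [h2, zero_mul] at h1
      linarith
    · exact absurd (sub_eq_zero.1 h2) hne
  have hwb : ∀ i, ⟪g, w i⟫ - b = 0 := by
    intro i
    by_contra hne
    refine hFG i (hF.eq_of_subset_hyperplane (h.isFacet_adj i) (h.normal i).1 (fun y hy => ?_)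
      (h.normal i).2.1)
    obtain ⟨c, rfl⟩ := h.exists_coords y
    have h1 := h.inner_sub_eq c i
    rcases mul_eq_zero.1 ((key c hy).2 i) with h2 | h2
    · rw [h2, zero_mul] at h1
      linarith
    · exact absurd h2 hne
  obtain ⟨c, hc⟩ := h.exists_coords (p + g)
  have h1 := inner_add_sum_smul_sub g p w c b
  rw [← hc, hpb, sub_self, mul_zero, zero_add, Finset.sum_eq_zero fun i _ => by
    rw [hwb i, mul_zero], inner_add_right, hpb, add_sub_cancel_left] at h1
  exact hg.1 (inner_self_eq_zero.1 h1)

/-- A facet other than `S` that contains all vertices of `S` but `w i` is among the `G j`.  Otherwise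
the apex would be strictly beneath it, and then all points of `G i` would have apex coordinate zero,
that is, lie in `S`. -/
theorem exists_eq_of_forall_mem (h : ApexConfig P S w G u ℓ p uS ℓS) (hP : IsDPolytope P)
    {F : Set (EucSpace d)} (hF : IsFacet P F) (hFS : F ≠ S) {i : Fin d}
    (hi : ∀ j, j ≠ i → w j ∈ F) : ∃ j, F = G j := by
  by_contra hne
  push Not at hne
  obtain ⟨g, b, hg, -⟩ := hF.exists_normal hP
  have hpb := h.lt_inner_apex_of_ne hF hFS hne hg
  have hGS : G i = S := by
    refine (h.isFacet_adj i).eq_of_subset_hyperplane h.isFacet h.normal_base.1 (fun y hy => ?_)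
      h.normal_base.2.1
    have hyP := (h.isFacet_adj i).subset hy
    have hyu := (h.normal i).2.1 y hy
    have hyg := hg.2.2 y hyP
    obtain ⟨c, rfl⟩ := h.exists_coords y
    have h1 := h.inner_sub_eq c i
    rw [hyu, sub_self] at h1
    have hci : c i = 0 := by
      rcases mul_eq_zero.1 h1.symm with h2 | h2
      · exact h2
      · linarith [h.lt_inner_vertex i]
    have h2 := inner_add_sum_smul_sub g p w c b
    rw [Finset.sum_eq_zero (s := Finset.univ) (f := fun i => c i * (⟪g, w i⟫ - b)), add_zero] at h2
    · have h3 := h.one_le_sum_coord hyP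
      have h4 := h.inner_base_sub_eq c
      have h5 : 1 - ∑ i, c i = 0 := by nlinarith
      rw [h5, zero_mul] at h4
      linarith
    · intro j _
      by_cases hj : j = i
      · rw [hj, hci, zero_mul]
      · rw [hg.2.1 _ (hi j hj), sub_self, mul_zero]
  exact (h.mem_iff i i).1 (hGS ▸ h.mem i) rfl

end ApexConfig

/-- Bounded position of a simplex facet provides an apex. -/
theorem exists_apexConfig {P S : Set (EucSpace d)} (hP : IsDPolytope P) (hd : 2 ≤ d)
    (hmd : m + 1 = d) (hS : IsFacet P S) {w : Fin (m + 1) → EucSpace d}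
    (hw : AffineIndependent ℝ w) (hSw : S = convexHull ℝ (Set.range w))
    (hSb : InBoundedPosition P S) :
    ∃ (w : Fin d → EucSpace d) (G : Fin d → Set (EucSpace d)) (u : Fin d → EucSpace d)
      (ℓ : Fin d → ℝ) (p uS : EucSpace d) (ℓS : ℝ), ApexConfig P S w G u ℓ p uS ℓS ∧
        ∀ F ∈ adjFacets P S, ∃ i, F = G i := by
  subst hmd
  choose G hG hmem using exists_adjFacet_forall_mem_iff_ne hP (by omega) rfl hS hw hSw
  choose u ℓ hu hGu using fun i => (hG i).1.exists_normal hP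
  have hinj : Function.Injective G := by
    intro i j hij
    by_contra hne
    exact (hmem i i).1 (hij ▸ (hmem j i).2 hne) rfl
  obtain ⟨p, hp, uS, ℓS, hSn, hSp⟩ := hSb (Set.range G) (by rintro _ ⟨i, rfl⟩; exact hG i) (by
    rw [← Set.image_univ, Set.ncard_image_of_injective _ hinj, Set.ncard_univ, Nat.card_fin])
  have hpG : ∀ i, ⟪u i, p⟫ = ℓ i := by
    intro i
    have h1 : p ∈ ⋂ F ∈ Set.range G, facetHyperplane F := hp ▸ Set.mem_singleton p
    rw [Set.mem_iInter₂] at h1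
    exact inner_eq_of_mem_affineSpan (hu i).2.1 (h1 (G i) ⟨i, rfl⟩)
  have hconf : ApexConfig P S w G u ℓ p uS ℓS :=
    { isFacet := hS
      mem := fun i => hSw ▸ subset_convexHull ℝ _ ⟨i, rfl⟩
      isFacet_adj := fun i => (hG i).1
      mem_iff := hmem
      normal := hu
      eq_zeroFace := hGu
      inner_apex := hpG
      normal_base := hSn
      inner_base_apex := hSp }
  refine ⟨w, G, u, ℓ, p, uS, ℓS, hconf, fun F hF => ?_⟩
  obtain ⟨i, hi⟩ := exists_forall_mem_iff_ne hP rfl hS hw hSw hF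
  refine hconf.exists_eq_of_forall_mem hP hF.1 ?_ fun j => (hi j).2
  rintro rfl
  exact (hi i).1 (hconf.mem i) rfl

/-! ### The stacking region -/

/-- The points of the stacking region are found close to the apex, since the hyperplanes of the
facets adjacent to `S` are in general position there. -/
theorem stackingRegion_nonempty {P S : Set (EucSpace d)} (hP : IsDPolytope P) (hd : 2 ≤ d)
    (hS : IsSimplexFacet P S) (hSb : InBoundedPosition P S) {A N : Set (Set (EucSpace d))}
    (hA : A ⊆ adjFacets P S) (hN : N ⊆ adjFacets P S) (hAN : Disjoint A N) :
    (stackingRegion P S A N).Nonempty := by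
  classical
  obtain ⟨hS, m, hmd, s, hSs⟩ := hS
  obtain ⟨w, G, u, ℓ, p, uS, ℓS, h, hadj⟩ :=
    exists_apexConfig hP hd hmd hS s.independent hSs hSb
  set σ : Fin d → ℝ := fun i => if G i ∈ A then 0 else if G i ∈ N then -1 else 1 with hσ
  set z : EucSpace d := ∑ i, σ i • (w i - p) with hz
  have hval : ∀ (ε : ℝ) i, ⟪u i, p + ε • z⟫ = ℓ i + ε * σ i * (⟪u i, w i⟫ - ℓ i) := by
    intro ε i
    have h1 := h.inner_sub_eq σ i
    rw [← hz, inner_add_right, h.inner_apex] at h1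
    rw [inner_add_right, real_inner_smul_right, h.inner_apex]
    linear_combination ε * h1
  have hcont : ∀ g : EucSpace d, Filter.Tendsto (fun ε : ℝ => ⟪g, p + ε • z⟫)
      (nhdsWithin 0 (Set.Ioi 0)) (nhds ⟪g, p⟫) := by
    intro g
    have h1 : Continuous fun ε : ℝ => ⟪g, p + ε • z⟫ := by fun_prop
    have h2 := (h1.tendsto 0).mono_left (nhdsWithin_le_nhds (s := Set.Ioi (0 : ℝ)))
    simpa using h2
  have hfar : ∀ᶠ ε in nhdsWithin (0 : ℝ) (Set.Ioi 0), ∀ F ∈ {F | IsFacet P F},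
      F ≠ S → (∀ i, F ≠ G i) → p + ε • z ∈ beneath P F := by
    rw [Filter.eventually_all_finite hP.finite_setOf_isFacet]
    intro F hF
    by_cases hc : F ≠ S ∧ ∀ i, F ≠ G i
    · obtain ⟨g, b, hg, -⟩ := IsFacet.exists_normal hP hF
      have hgp := h.lt_inner_apex_of_ne hF hc.1 hc.2 hg
      filter_upwards [(hcont g).eventually (lt_mem_nhds hgp)] with ε hε _ _
      exact ⟨g, b, hg, hε⟩
    · exact Filter.Eventually.of_forall fun ε h1 h2 => absurd ⟨h1, h2⟩ hc
  obtain ⟨ε, ⟨hε1, hε2⟩, hε⟩ := ((hfar.and ((hcont uS).eventually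
    (gt_mem_nhds h.inner_base_apex))).and self_mem_nhdsWithin).exists
  have hε' : 0 < ε := hε
  refine ⟨p + ε • z, fun F hF hFA hFN hFS => ?_, fun F hF => ?_, fun F hF => ?_,
    uS, ℓS, h.normal_base, hε2⟩
  · by_cases hc : ∀ i, F ≠ G i
    · exact hε1 F hF hFS hc
    · push Not at hc
      obtain ⟨i, rfl⟩ := hc
      refine ⟨u i, ℓ i, h.normal i, ?_⟩
      have h1 : σ i = 1 := by rw [hσ]; simp only [if_neg hFA, if_neg hFN]
      rw [hval, h1]
      have := mul_pos hε' (sub_pos.2 (h.lt_inner_vertex i))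
      linarith
  · obtain ⟨i, rfl⟩ := hadj F (hA hF)
    have h1 : σ i = 0 := by rw [hσ]; simp only [if_pos hF]
    rw [facetHyperplane, (h.isFacet_adj i).affineSpan_eq (h.normal i).1 (h.normal i).2.1]
    change ⟪u i, p + ε • z⟫ = ℓ i
    rw [hval, h1]
    ring
  · obtain ⟨i, rfl⟩ := hadj F (hN hF)
    have h1 : σ i = -1 := by
      rw [hσ]
      simp only [if_neg (Set.disjoint_right.1 hAN hF), if_pos hF]
    refine ⟨u i, ℓ i, h.normal i, ?_⟩
    rw [hval, h1]
    have := mul_pos hε' (sub_pos.2 (h.lt_inner_vertex i))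
    linarith

theorem mem_of_mem_stackingRegion_of_mem_affineSpan {P S G : Set (EucSpace d)}
    {A N : Set (Set (EucSpace d))} {v : EucSpace d} (hv : v ∈ stackingRegion P S A N)
    (hG : IsFacet P G) (hvG : v ∈ affineSpan ℝ G) : G ∈ A := by
  obtain ⟨h1, -, h3, h4⟩ := hv
  have key : ∀ u ℓ, IsInnerNormal P G u ℓ → ⟪u, v⟫ = ℓ := fun u ℓ hu =>
    inner_eq_of_mem_affineSpan hu.2.1 hvG
  by_contra hGA
  by_cases hGN : G ∈ N
  · obtain ⟨u, ℓ, hu, hlt⟩ := h3 G hGN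
    exact hlt.ne (key u ℓ hu)
  by_cases hGS : G = S
  · obtain ⟨u, ℓ, hu, hlt⟩ := h4
    exact hlt.ne (key u ℓ (hGS ▸ hu))
  · obtain ⟨u, ℓ, hu, hlt⟩ := h1 G hG hGA hGN hGS
    exact hlt.ne' (key u ℓ hu)

/-- Any two facets adjacent to a simplex facet have a common subridge with it. -/
theorem exists_isSubridge_subset_inter {P S G G' : Set (EucSpace d)} (hP : IsDPolytope P)
    (hd : 3 ≤ d) (hS : IsSimplexFacet P S) (hG : G ∈ adjFacets P S) (hG' : G' ∈ adjFacets P S) :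
    ∃ R, IsSubridge P R ∧ R ⊆ S ∩ G ∩ G' := by
  classical
  obtain ⟨hS, m, hmd, s, hSs⟩ := hS
  obtain ⟨i, hi⟩ := exists_forall_mem_iff_ne hP hmd hS s.independent hSs hG
  obtain ⟨i', hi'⟩ := exists_forall_mem_iff_ne hP hmd hS s.independent hSs hG'
  have hcard : (m - 2) + 1 ≤ ({i, i'}ᶜ : Finset (Fin (m + 1))).card := by
    have := Finset.card_le_two (a := i) (b := i')
    rw [Finset.card_compl, Fintype.card_fin]
    omega
  obtain ⟨T, hT, hTc⟩ := Finset.exists_subset_card_eq hcard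
  refine ⟨_, ⟨m - 2, by omega, isFaceOfDim_convexHull_image hP hS s.independent hSs hTc⟩, ?_⟩
  refine convexHull_min ?_ (((hS.convex hP).inter (hG.1.convex hP)).inter (hG'.1.convex hP))
  rintro _ ⟨j, hj, rfl⟩
  have h1 := hT hj
  simp only [Finset.mem_compl, Finset.mem_insert, Finset.mem_singleton, not_or] at h1
  exact ⟨⟨hSs ▸ subset_convexHull ℝ _ ⟨j, rfl⟩, (hi j).2 h1.1⟩, (hi' j).2 h1.2⟩

/-- The hyperplanes that contain the new vertex are those of the facets in `A`, of which no two are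
adjacent; so they do not meet in a ridge of `P`. -/
theorem notMem_affineSpan_of_isRidge {P S R : Set (EucSpace d)} (hP : IsDPolytope P)
    (hd : 3 ≤ d) (hS : IsSimplexFacet P S) {A N : Set (Set (EucSpace d))}
    (hA : A ⊆ adjFacets P S) (hns : IsNonsimple P S A) {v : EucSpace d}
    (hv : v ∈ stackingRegion P S A N) (hR : IsRidge P R) : v ∉ affineSpan ℝ R := by
  intro hvR
  obtain ⟨r, hr, hRf⟩ := id hR
  obtain ⟨G, hG, hRG⟩ := hRf.exists_superset hP (n := d - 1) (by omega) (by omega)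
  have hG : IsFacet P G := ⟨d - 1, by omega, hG⟩
  obtain ⟨G', hG', hGG'⟩ := hR.exists_facet_inter_eq hP hG hRG
  have hRG' : R ⊆ G' := hGG' ▸ Set.inter_subset_right
  have hGA := mem_of_mem_stackingRegion_of_mem_affineSpan hv hG (affineSpan_mono ℝ hRG hvR)
  have hGA' := mem_of_mem_stackingRegion_of_mem_affineSpan hv hG' (affineSpan_mono ℝ hRG' hvR)
  exact hns ⟨G, hGA, G', hGA', ⟨hG', hGG' ▸ hR⟩,
    exists_isSubridge_subset_inter hP hd hS (hA hGA) (hA hGA')⟩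

/-! ### Faces of a pseudo-stacking -/

theorem IsDPolytope.convexHull_union_singleton {P : Set (EucSpace d)} (hP : IsDPolytope P)
    (v : EucSpace d) : IsDPolytope (convexHull ℝ (P ∪ {v})) := by
  refine ⟨?_, ?_⟩
  · obtain ⟨⟨V, hV, rfl⟩, -⟩ := hP
    exact ⟨V ∪ {v}, hV.union (Set.finite_singleton v), convexHull_convexHull_union_left ..⟩
  · rw [affineSpan_convexHull, eq_top_iff, ← hP.2]
    exact affineSpan_mono ℝ Set.subset_union_left

/-- In a `k`-simplicial polytope all faces of dimension at most `k` are simplices. -/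
theorem IsKSimplicial.isSimplexOfDim {P F : Set (EucSpace d)} {k n : ℕ} (hP : IsDPolytope P)
    (hPk : IsKSimplicial k P) (hF : IsFaceOfDim P n F) (hnk : n ≤ k) (hk : k ≤ d) :
    IsSimplexOfDim n F := by
  obtain ⟨K, hK, hFK⟩ := hF.exists_superset hP hnk hk
  obtain ⟨u, ℓ, hl, hFu⟩ := hF.exists_eq_zeroFace
  have hFK' : F = zeroFace K u ℓ := by
    refine Set.Subset.antisymm (fun x hx => ⟨hFK hx, ?_⟩) fun x hx => ?_
    · rw [hFu] at hx
      exact hx.2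
    · rw [hFu]
      exact ⟨hK.subset hx.1, hx.2⟩
  have hne := hF.2.1
  have hdim := hF.2.2
  rw [hFK'] at hne hdim ⊢
  exact (hPk K hK).zeroFace (fun x hx => hl x (hK.subset hx)) hne hdim

theorem theorem2p9 (d k : ℕ) (hd : 3 ≤ d) (hk : 1 ≤ k) (hkd : k + 2 ≤ d)
    (P : Set (EucSpace d)) (hP : IsDPolytope P) (hPk : IsKSimplicial k P)
    (S : Set (EucSpace d)) (hS : IsSimplexFacet P S) (hSb : InBoundedPosition P S)
    (A N : Set (Set (EucSpace d))) (hA : A ⊆ adjFacets P S) (hN : N ⊆ adjFacets P S)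
    (hAN : Disjoint A N) (hns : IsNonsimple P S A) :
    (∃ Q, IsPseudoStacking P S A N Q) ∧
      ∀ Q, IsPseudoStacking P S A N Q → IsDPolytope Q ∧ IsKSimplicial k Q := by
  refine ⟨?_, ?_⟩
  · obtain ⟨v, hv⟩ := stackingRegion_nonempty hP (by omega) hS hSb hA hN hAN
    exact ⟨_, v, hv, rfl⟩
  rintro _ ⟨v, hv, rfl⟩
  refine ⟨hP.convexHull_union_singleton v, fun F hF => ?_⟩
  obtain ⟨u, ℓ, hl, hFu⟩ := hF.exists_eq_zeroFace
  have hl' : ∀ x ∈ P ∪ {v}, ℓ ≤ ⟪u, x⟫ := fun x hx => hl x (subset_convexHull ℝ _ hx)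
  have hlP : ∀ x ∈ P, ℓ ≤ ⟪u, x⟫ := fun x hx => hl' x (Or.inl hx)
  rw [zeroFace_convexHull hl'] at hFu
  have hconv : Convex ℝ (zeroFace P u ℓ) := hP.convex.inter (convex_inner_eq u ℓ)
  have hdim := hF.2.2
  by_cases hvF : ⟪u, v⟫ = ℓ
  · have hins : zeroFace (P ∪ {v}) u ℓ = insert v (zeroFace P u ℓ) := by
      ext x
      constructor
      · rintro ⟨hx | rfl, hxl⟩
        · exact Or.inr ⟨hx, hxl⟩
        · exact Or.inl rfl
      · rintro (rfl | hx)
        · exact ⟨Or.inr rfl, hvF⟩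
        · exact ⟨Or.inl hx.1, hx.2⟩
    rw [hins] at hFu
    rw [hFu, vectorSpan_convexHull] at hdim
    have hne : (zeroFace P u ℓ).Nonempty := by
      -- otherwise the face is the single point `v`, of dimension `0 < k`
      by_contra hemp
      rw [Set.not_nonempty_iff_eq_empty] at hemp
      rw [hemp, insert_empty_eq, vectorSpan_singleton, finrank_bot] at hdim
      omega
    have hface := isFaceOfDim_zeroFace hlP hne
    by_cases hvs : v ∈ affineSpan ℝ (zeroFace P u ℓ)
    · rw [vectorSpan_insert_of_mem_affineSpan hvs] at hdim
      rw [hdim] at hface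
      obtain ⟨R, hR, hsub⟩ := hface.exists_superset hP (n := d - 2) (by omega) (by omega)
      exact absurd (affineSpan_mono ℝ hsub hvs) (notMem_affineSpan_of_isRidge hP hd hS hA hns hv
        ⟨d - 2, by omega, hR⟩)
    · rw [finrank_vectorSpan_insert_of_notMem hne hvs] at hdim
      rw [hFu, ← hdim]
      exact (hPk.isSimplexOfDim hP hface (by omega) (by omega)).convexHull_insert hvs
  · have hsame : zeroFace (P ∪ {v}) u ℓ = zeroFace P u ℓ := by
      ext x
      constructor
      · rintro ⟨hx | rfl, hxl⟩
        · exact ⟨hx, hxl⟩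
        · exact absurd hxl hvF
      · exact fun hx => ⟨Or.inl hx.1, hx.2⟩
    rw [hsame, hconv.convexHull_eq] at hFu
    have hne := hF.2.1
    rw [hFu] at hne hdim
    have hface := isFaceOfDim_zeroFace hlP hne
    rw [hdim, ← hFu] at hface
    exact hPk F hface
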